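/- For integers $r \ge 2$ and $n \ge 1$, let $p_r(n)$ denote the probability that a uniformly random permutation $\sigma$ of $[n]=\{1,2,\ldots,n\}$ has an $r$-th root, that is, the number of $\sigma \in S_n$ for which there is a $\pi \in S_n$ with $\pi^r=\sigma$, divided by $n!$. Let $q$ be a prime, let $l \ge 1$ be an integer, and let $r=q^l$. Then for every positive integer $n$, $p_r(n) \ge p_r(n+1)$. -/

import Mathlib

/-- A permutation `σ` has an `r`-th root if `π ^ r = σ` for some permutation `π` of the same set. -/
def HasPermRoot {α : Type*} (r : ℕ) (σ : Equiv.Perm α) : Prop :=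
  ∃ π : Equiv.Perm α, π ^ r = σ

/-- The probability `p_r(n)` that a uniformly random permutation of an `n`-element set has an
`r`-th root: the number of permutations with an `r`-th root over the number of all permutations. -/
noncomputable def rootProb (r n : ℕ) : ℝ :=
  (Nat.card {σ : Equiv.Perm (Fin n) // HasPermRoot r σ} : ℝ) / (Nat.card (Equiv.Perm (Fin n)) : ℝ)

/-! An `m`-cycle raised to the power `r` splits into `gcd(m, r)` cycles of equal length. Hence, for
`r = q ^ l`, a permutation has an `r`-th root iff for every `k` divisible by `q` its number of
`k`-cycles is a multiple of `r` (`hasPermRoot_prime_pow_iff`). By Cauchy's count of a cycle type,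
the generating function P of the probabilities is the product of exp(x^k/k) over `q ∤ k` and of ∑
(x^k/k)^(rj)/(rj)! over `q ∣ k`.

Since ∏ exp(x^k/k) over all k is 1/(1-x), (1-x)P = B·V, where B = ∏_{q∣k} exp(-x^k/k) =
(1-x^q)^(1/q) and V collects the factors with `q ∣ k`. The claim is that B·V has no positive
coefficient in degree ≥ 1. Both constant terms are 1, V is nonnegative and B is nonpositive in
positive degrees, so V_n ≤ -B_n suffices (`coeff_mul_nonpos`).

For this, V is majorised by D = ∏_{q∣k} exp(x^(rk)/(r! k^r)). The logarithmic derivative gives a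
recurrence showing that the coefficients of D in degree rqt are O(1/t²) with a small explicit
constant, whereas those of -B decay only like t^(-1-1/q) (`seq_le_binomProd`,
`coeff_prod_rootFactor_le`).

All products are cut off at a bound N, which is harmless in degrees up to N. -/

section

/-! ### Products of exponentials of monomials. -/

open PowerSeries Finset

/-- The power series `∑ j, f j * X ^ (d * j)`. -/
noncomputable def spreadSeries (f : ℕ → ℝ) (d : ℕ) : PowerSeries ℝ :=
  PowerSeries.mk fun n => if d ∣ n then f (n / d) else 0

lemma coeff_spreadSeries (f : ℕ → ℝ) (d n : ℕ) :
    coeff n (spreadSeries f d) = if d ∣ n then f (n / d) else 0 := by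
  simp [spreadSeries]

/-- The power series `exp (c * X ^ d)`. -/
noncomputable def expMonomial (c : ℝ) (d : ℕ) : PowerSeries ℝ :=
  spreadSeries (fun j => c ^ j / (j.factorial : ℝ)) d

lemma coeff_zero_expMonomial (c : ℝ) (d : ℕ) : coeff 0 (expMonomial c d) = 1 := by
  simp [expMonomial, coeff_spreadSeries]

lemma X_mul_derivative_expMonomial (c : ℝ) {d : ℕ} (hd : 0 < d) :
    X * derivative ℝ (expMonomial c d) = expMonomial c d * (C (d * c) * X ^ d) := by
  ext n
  rw [← mul_assoc, coeff_mul_X_pow', mul_comm (expMonomial c d), coeff_C_mul]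
  rcases n with _ | n
  · simp [hd.ne']
  rw [coeff_succ_X_mul, coeff_derivative]
  simp only [expMonomial, coeff_spreadSeries]
  by_cases h : d ∣ n + 1
  · obtain ⟨j, hj⟩ := h
    rcases j with _ | j
    · simp at hj
    have h1 : d ≤ n + 1 := by rw [hj]; nlinarith
    have h2 : n + 1 - d = d * j := by rw [hj]; rw [mul_add]; simp
    have h3 : ((n : ℝ) + 1) = d * (j + 1) := by exact_mod_cast hj
    rw [h3, if_pos h1, h2, hj]
    simp only [dvd_mul_right, if_true, Nat.mul_div_cancel_left _ hd, Nat.factorial_succ]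
    have := Nat.factorial_ne_zero j
    have : (j : ℝ) + 1 ≠ 0 := by positivity
    push_cast
    field_simp
    ring
  · rw [if_neg h, zero_mul]
    split_ifs with h1 h2
    · exfalso
      exact h ((Nat.dvd_sub_iff_left h1 dvd_rfl).1 h2)
    · simp
    · rfl

/-- The logarithmic derivatives cancel, so the product is constant. -/
lemma expMonomial_mul_neg (c : ℝ) {d : ℕ} (hd : 0 < d) :
    expMonomial c d * expMonomial (-c) d = 1 := by
  have h : X * derivative ℝ (expMonomial c d * expMonomial (-c) d) = 0 := by
    have h1 := X_mul_derivative_expMonomial c hd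
    have h2 := X_mul_derivative_expMonomial (-c) hd
    rw [Derivation.leibniz, smul_eq_mul, smul_eq_mul]
    rw [mul_add, mul_left_comm, h2, mul_left_comm X, h1, mul_neg, map_neg]
    ring
  ext n
  rcases n with _ | n
  · simp [coeff_zero_expMonomial, coeff_mul]
  · have := congrArg (coeff (n + 1)) h
    rw [coeff_succ_X_mul, coeff_derivative] at this
    simp only [map_zero, mul_eq_zero] at this
    rw [this.resolve_right (by positivity)]
    simp [coeff_one]

lemma X_mul_derivative_prod_expMonomial {ι : Type*} (S : Finset ι) (c : ι → ℝ) (d : ι → ℕ)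
    (hd : ∀ k ∈ S, 0 < d k) :
    X * derivative ℝ (∏ k ∈ S, expMonomial (c k) (d k)) =
      (∏ k ∈ S, expMonomial (c k) (d k)) * ∑ k ∈ S, C (d k * c k) * X ^ d k := by
  classical
  induction S using Finset.induction_on with
  | empty => simp
  | insert a S ha ih =>
    rw [prod_insert ha, sum_insert ha, Derivation.leibniz, smul_eq_mul, smul_eq_mul, mul_add,
      mul_left_comm, ih (fun k hk => hd k (mem_insert_of_mem hk)), mul_left_comm X,
      X_mul_derivative_expMonomial _ (hd a (mem_insert_self _ _))]
    ring

lemma coeff_zero_prod_expMonomial {ι : Type*} (S : Finset ι) (c : ι → ℝ) (d : ι → ℕ) :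
    coeff 0 (∏ k ∈ S, expMonomial (c k) (d k)) = 1 := by
  rw [coeff_zero_eq_constantCoeff, map_prod]
  refine prod_eq_one fun k _ => ?_
  rw [← coeff_zero_eq_constantCoeff, coeff_zero_expMonomial]

/-- Logarithmic differentiation turns the product into a linear recurrence. Everything needed later
about the coefficients of 1/(1-x), B and D is extracted from it. -/
lemma coeff_prod_expMonomial_recurrence {ι : Type*} (S : Finset ι) (c : ι → ℝ) (d : ι → ℕ)
    (hd : ∀ k ∈ S, 0 < d k) (n : ℕ) :
    (n : ℝ) * coeff n (∏ k ∈ S, expMonomial (c k) (d k)) =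
      ∑ k ∈ S, if d k ≤ n then
        (d k * c k) * coeff (n - d k) (∏ k ∈ S, expMonomial (c k) (d k)) else 0 := by
  have h := congrArg (coeff n) (X_mul_derivative_prod_expMonomial S c d hd)
  rw [mul_sum, map_sum] at h
  have h1 : coeff n (X * derivative ℝ (∏ k ∈ S, expMonomial (c k) (d k))) =
      (n : ℝ) * coeff n (∏ k ∈ S, expMonomial (c k) (d k)) := by
    rcases n with _ | n
    · simp
    · rw [coeff_succ_X_mul, coeff_derivative]; push_cast; ring
  rw [← h1, h]
  refine sum_congr rfl fun k _ => ?_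
  rw [← mul_assoc, coeff_mul_X_pow', mul_comm _ (C _), coeff_C_mul]

lemma coeff_prod_expMonomial_eq_zero {ι : Type*} (S : Finset ι) (c : ι → ℝ) (d : ι → ℕ)
    (hd : ∀ k ∈ S, 0 < d k) {s : ℕ} (hs : ∀ k ∈ S, s ∣ d k) (n : ℕ) (hn : ¬ s ∣ n) :
    coeff n (∏ k ∈ S, expMonomial (c k) (d k)) = 0 := by
  induction n using Nat.strong_induction_on with
  | _ n ih =>
    have hn0 : n ≠ 0 := by rintro rfl; simp at hn
    have h := coeff_prod_expMonomial_recurrence S c d hd n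
    rw [sum_eq_zero] at h
    · exact (mul_eq_zero.1 h).resolve_left (by exact_mod_cast hn0)
    · intro k hk
      split_ifs with hkn
      · rw [ih, mul_zero]
        · have := hd k hk; omega
        · exact fun h' => hn ((Nat.dvd_sub_iff_left hkn (hs k hk)).1 h')
      · rfl

/-- The product is a truncation of exp(-log(1-x)) = 1/(1-x). -/
lemma coeff_prod_expMonomial_inv (N n : ℕ) (hn : n ≤ N) :
    coeff n (∏ k ∈ Icc 1 N, expMonomial (1 / (k : ℝ)) k) = 1 := by
  induction n using Nat.strong_induction_on with
  | _ n ih =>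
    rcases Nat.eq_zero_or_pos n with rfl | hn0
    · exact coeff_zero_prod_expMonomial _ _ _
    have h := coeff_prod_expMonomial_recurrence (Icc 1 N) (fun k => 1 / (k : ℝ)) (fun k => k)
      (fun k hk => (mem_Icc.1 hk).1) n
    have h2 : ∀ k ∈ Icc 1 N, (if k ≤ n then ((k : ℝ) * (1 / (k : ℝ))) *
        coeff (n - k) (∏ k ∈ Icc 1 N, expMonomial (1 / (k : ℝ)) k) else 0) =
        if k ≤ n then 1 else 0 := by
      intro k hk
      have hk1 := (mem_Icc.1 hk).1
      split_ifs with hkn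
      · rw [ih _ (by omega) (by omega)]
        have : (k : ℝ) ≠ 0 := by positivity
        field_simp
      · rfl
    rw [sum_congr rfl h2, ← sum_filter] at h
    have h3 : (Icc 1 N).filter (· ≤ n) = Icc 1 n := by ext; simp; omega
    rw [h3] at h
    simp only [sum_const, Nat.card_Icc, add_tsub_cancel_right, nsmul_eq_mul, mul_one] at h
    have : (n : ℝ) ≠ 0 := by positivity
    exact mul_left_cancel₀ this (by rw [h, mul_one])

lemma coeff_one_sub_X_mul_prod_expMonomial (N n : ℕ) (hn : n ≤ N) :
    coeff n ((1 - X) * ∏ k ∈ Icc 1 N, expMonomial (1 / (k : ℝ)) k) = if n = 0 then 1 else 0 := by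
  rw [sub_mul, one_mul, map_sub, coeff_prod_expMonomial_inv N n hn]
  rcases n with _ | n
  · simp
  · rw [coeff_succ_X_mul, coeff_prod_expMonomial_inv N n (by omega)]; simp

lemma coeff_prod_nonneg {ι : Type*} (S : Finset ι) (f : ι → PowerSeries ℝ)
    (h : ∀ k ∈ S, ∀ n, 0 ≤ coeff n (f k)) (n : ℕ) : 0 ≤ coeff n (∏ k ∈ S, f k) := by
  classical
  induction S using Finset.induction_on generalizing n with
  | empty => rw [prod_empty, coeff_one]; split_ifs <;> simp
  | insert a S ha ih =>
    rw [prod_insert ha, coeff_mul]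
    exact sum_nonneg fun p _ => mul_nonneg (h a (mem_insert_self _ _) _)
      (ih (fun k hk => h k (mem_insert_of_mem hk)) _)

lemma coeff_prod_le_coeff_prod {ι : Type*} (S : Finset ι) (f g : ι → PowerSeries ℝ)
    (h : ∀ k ∈ S, ∀ n, 0 ≤ coeff n (f k)) (hfg : ∀ k ∈ S, ∀ n, coeff n (f k) ≤ coeff n (g k))
    (n : ℕ) : coeff n (∏ k ∈ S, f k) ≤ coeff n (∏ k ∈ S, g k) := by
  classical
  induction S using Finset.induction_on generalizing n with
  | empty => simp
  | insert a S ha ih =>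
    rw [prod_insert ha, prod_insert ha, coeff_mul, coeff_mul]
    refine sum_le_sum fun p _ => mul_le_mul (hfg a (mem_insert_self _ _) _)
      (ih (fun k hk => h k (mem_insert_of_mem hk)) (fun k hk => hfg k (mem_insert_of_mem hk)) _)
      (coeff_prod_nonneg _ _ (fun k hk => h k (mem_insert_of_mem hk)) _)
      ((h a (mem_insert_self _ _) _).trans (hfg a (mem_insert_self _ _) _))

/-- The power series `∑ j, z ^ (r * j) / (r * j)!` evaluated at `z = X ^ d / d`. -/
noncomputable def rootFactor (r d : ℕ) : PowerSeries ℝ :=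
  spreadSeries (fun j => if r ∣ j then (1 / (d : ℝ)) ^ j / (j.factorial : ℝ) else 0) d

lemma coeff_rootFactor_nonneg (r d n : ℕ) : 0 ≤ coeff n (rootFactor r d) := by
  rw [rootFactor, coeff_spreadSeries]
  split_ifs <;> positivity

lemma coeff_zero_rootFactor (r d : ℕ) : coeff 0 (rootFactor r d) = 1 := by
  simp [rootFactor, coeff_spreadSeries]

/-- This amounts to (r!)^j j! ≤ (rj)!: the quotient counts the partitions of rj points into j blocks
of size r. -/
lemma coeff_rootFactor_le {r d : ℕ} (hr : 0 < r) (hd : 0 < d) (n : ℕ) :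
    coeff n (rootFactor r d) ≤
      coeff n (expMonomial (1 / ((r.factorial : ℝ) * (d : ℝ) ^ r)) (r * d)) := by
  rw [rootFactor, expMonomial, coeff_spreadSeries, coeff_spreadSeries]
  by_cases h : r * d ∣ n
  · obtain ⟨j, rfl⟩ := h
    have e1 : r * d * j = d * (r * j) := by ring
    rw [if_pos (dvd_mul_right _ _), Nat.mul_div_cancel_left _ (by positivity), e1,
      if_pos (dvd_mul_right _ _), Nat.mul_div_cancel_left _ hd, if_pos (dvd_mul_right _ _)]
    have h1 : r.factorial ^ j * j.factorial ≤ (r * j).factorial := by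
      have h2 := Nat.uniformBell_mul_eq j hr.ne'
      rw [mul_comm r j, ← h2, mul_assoc]
      refine Nat.le_mul_of_pos_left _ (Nat.pos_of_ne_zero fun h0 => ?_)
      rw [h0] at h2
      simp only [zero_mul] at h2
      exact Nat.factorial_ne_zero _ h2.symm
    have h3 : (r.factorial : ℝ) ^ j * (j.factorial : ℝ) ≤ ((r * j).factorial : ℝ) := by
      exact_mod_cast h1
    have : (0 : ℝ) < r.factorial := by exact_mod_cast Nat.factorial_pos r
    have : (0 : ℝ) < j.factorial := by exact_mod_cast Nat.factorial_pos j
    have : (0 : ℝ) < d := by exact_mod_cast hd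
    rw [div_pow, div_pow, one_pow, one_pow, mul_pow, ← pow_mul, div_div, div_div]
    refine one_div_le_one_div_of_le (by positivity) ?_
    calc (r.factorial : ℝ) ^ j * (d : ℝ) ^ (r * j) * (j.factorial : ℝ)
        = (d : ℝ) ^ (r * j) * ((r.factorial : ℝ) ^ j * (j.factorial : ℝ)) := by ring
      _ ≤ _ := by gcongr
  · rw [if_neg h]
    split_ifs with h1 h2
    · exact absurd (by
        obtain ⟨a, rfl⟩ := h1
        rw [Nat.mul_div_cancel_left _ hd] at h2
        rw [mul_comm r d]; exact mul_dvd_mul_left d h2) h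
    · rfl
    · rfl

end

/-! ### Numerical estimates for the recurrences. -/

section

open PowerSeries Finset

/-- The product `∏ (1 - 1 / (q * j))` over `1 ≤ j < m`. -/
noncomputable def binomProd (q m : ℕ) : ℝ := ∏ j ∈ Ico 1 m, (1 - 1 / ((q : ℝ) * j))

lemma binomProd_succ (q : ℕ) {m : ℕ} (hm : 1 ≤ m) :
    binomProd q (m + 1) = binomProd q m * (1 - 1 / ((q : ℝ) * m)) := by
  rw [binomProd, prod_Ico_succ_top hm, binomProd]

lemma one_sub_one_div_le {q j : ℕ} (hq : 2 ≤ q) (hj : 1 ≤ j) :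
    1 - 1 / (2 * (j : ℝ)) ≤ 1 - 1 / ((q : ℝ) * j) := by
  have : (2 : ℝ) ≤ q := by exact_mod_cast hq
  have : (1 : ℝ) ≤ j := by exact_mod_cast hj
  gcongr

lemma binomProd_two_le {q : ℕ} (hq : 2 ≤ q) (m : ℕ) : binomProd 2 m ≤ binomProd q m := by
  refine prod_le_prod (fun j hj => ?_) (fun j hj => ?_)
  · have : (1 : ℝ) ≤ j := by exact_mod_cast (mem_Ico.1 hj).1
    rw [sub_nonneg, div_le_one (by push_cast; positivity)]
    push_cast; linarith
  · exact_mod_cast one_sub_one_div_le hq (mem_Ico.1 hj).1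

/-- The factor 4m - 3 makes m = 1 an equality and the induction nearly exact: (4m + 1)(1 - 1/(2m))²
= 4m - 3 + 1/(4m²). -/
lemma binomProd_two_sq_aux {m : ℕ} (hm : 1 ≤ m) :
    0 < binomProd 2 m ∧ 1 ≤ (4 * (m : ℝ) - 3) * binomProd 2 m ^ 2 := by
  induction m, hm using Nat.le_induction with
  | base => norm_num [binomProd]
  | succ m hm ih =>
    obtain ⟨h0, h1⟩ := ih
    have hm' : (1 : ℝ) ≤ m := by exact_mod_cast hm
    rw [binomProd_succ 2 hm]
    have h2 : 0 < 1 - 1 / (((2 : ℕ) : ℝ) * m) := by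
      rw [sub_pos, div_lt_one (by push_cast; positivity)]
      push_cast; linarith
    refine ⟨mul_pos h0 h2, ?_⟩
    have h3 : 4 * (m : ℝ) - 3 ≤ (4 * ((m + 1 : ℕ) : ℝ) - 3) *
        (1 - 1 / (((2 : ℕ) : ℝ) * m)) ^ 2 := by
      have : (4 * ((m + 1 : ℕ) : ℝ) - 3) * (1 - 1 / (((2 : ℕ) : ℝ) * m)) ^ 2 =
          4 * (m : ℝ) - 3 + 1 / (4 * (m : ℝ) ^ 2) := by
        push_cast; field_simp; ring
      rw [this]
      have : 0 ≤ 1 / (4 * (m : ℝ) ^ 2) := by positivity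
      linarith
    calc 1 ≤ (4 * (m : ℝ) - 3) * binomProd 2 m ^ 2 := h1
      _ ≤ ((4 * ((m + 1 : ℕ) : ℝ) - 3) * (1 - 1 / (((2 : ℕ) : ℝ) * m)) ^ 2) *
          binomProd 2 m ^ 2 := by gcongr
      _ = _ := by ring

lemma binomProd_two_sq {m : ℕ} (hm : 1 ≤ m) :
    0 < binomProd 2 m ∧ 1 / (4 * (m : ℝ)) ≤ binomProd 2 m ^ 2 := by
  obtain ⟨h0, h1⟩ := binomProd_two_sq_aux hm
  refine ⟨h0, ?_⟩
  have hm' : (1 : ℝ) ≤ m := by exact_mod_cast hm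
  rw [div_le_iff₀ (by positivity)]
  nlinarith [sq_nonneg (binomProd 2 m)]

lemma sum_Ico_inv_sq_le {n : ℕ} (hn : 1 ≤ n) :
    ∑ j ∈ Ico 1 (n + 1), 1 / (j : ℝ) ^ 2 ≤ 2 - 1 / (n : ℝ) := by
  induction n, hn using Nat.le_induction with
  | base => norm_num
  | succ n hn ih =>
    rw [sum_Ico_succ_top (by omega)]
    have hn' : (1 : ℝ) ≤ n := by exact_mod_cast hn
    have : 1 / ((n + 1 : ℕ) : ℝ) ^ 2 ≤ 1 / (n : ℝ) - 1 / ((n + 1 : ℕ) : ℝ) := by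
      push_cast
      rw [div_sub_div _ _ (by positivity) (by positivity), div_le_div_iff₀ (by positivity)
        (by positivity)]
      nlinarith
    linarith

/-- Partial fractions: 1/(k(t-k)²) = (1/t)(1/(k(t-k)) + 1/(t-k)²). The two resulting sums are at
most 1, as k(t-k) ≥ t - 1, and at most 2. -/
lemma sum_Ico_inv_mul_sq_le (t : ℕ) :
    ∑ k ∈ Ico 1 t, 1 / ((k : ℝ) * ((t - k : ℕ) : ℝ) ^ 2) ≤ 3 / (t : ℝ) := by
  rcases Nat.lt_or_ge t 2 with h | h
  · rw [Ico_eq_empty (by omega), sum_empty]; positivity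
  obtain ⟨n, rfl⟩ : ∃ n, t = n + 1 := ⟨t - 1, by omega⟩
  have hn : 1 ≤ n := by omega
  have hn' : (1 : ℝ) ≤ n := by exact_mod_cast hn
  have h1 : ∑ k ∈ Ico 1 (n + 1), 1 / ((n + 1 - k : ℕ) : ℝ) ^ 2 ≤ 2 := by
    have h2 := sum_Ico_inv_sq_le hn
    have h3 : (0 : ℝ) ≤ 1 / (n : ℝ) := by positivity
    calc _ = ∑ j ∈ Ico 1 (n + 1), 1 / (j : ℝ) ^ 2 := by
          refine sum_nbij' (fun k => n + 1 - k) (fun k => n + 1 - k) ?_ ?_ ?_ ?_ ?_ <;>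
            (intro k hk; simp only [mem_Ico] at *) <;> omega
      _ ≤ 2 := by linarith
  have h2 : ∑ k ∈ Ico 1 (n + 1), 1 / ((k : ℝ) * ((n + 1 - k : ℕ) : ℝ)) ≤ 1 := by
    calc _ ≤ ∑ k ∈ Ico 1 (n + 1), 1 / (n : ℝ) := by
          refine sum_le_sum fun k hk => ?_
          rw [mem_Ico] at hk
          refine one_div_le_one_div_of_le (by positivity) ?_
          have : n ≤ k * (n + 1 - k) := by
            obtain ⟨a, rfl⟩ : ∃ a, k = a + 1 := ⟨k - 1, by omega⟩
            obtain ⟨b, rfl⟩ : ∃ b, n = a + 1 + b := ⟨n - (a + 1), by omega⟩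
            rw [show a + 1 + b + 1 - (a + 1) = b + 1 by omega]
            nlinarith [Nat.zero_le (a * b)]
          exact_mod_cast this
      _ = 1 := by
          rw [sum_const, Nat.card_Ico, nsmul_eq_mul]
          simp; field_simp
  have h3 : ∀ k ∈ Ico 1 (n + 1), 1 / ((k : ℝ) * ((n + 1 - k : ℕ) : ℝ) ^ 2) =
      1 / ((n + 1 : ℕ) : ℝ) * (1 / ((k : ℝ) * ((n + 1 - k : ℕ) : ℝ)) +
        1 / ((n + 1 - k : ℕ) : ℝ) ^ 2) := by
    intro k hk
    rw [mem_Ico] at hk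
    obtain ⟨b, hb⟩ : ∃ b, n + 1 = k + b := ⟨n + 1 - k, by omega⟩
    rw [hb, Nat.add_sub_cancel_left]
    have hb' : (0 : ℝ) < b := by exact_mod_cast (by omega : 0 < b)
    have hk' : (0 : ℝ) < k := by exact_mod_cast (by omega : 0 < k)
    push_cast
    field_simp
    ring
  refine (sum_congr rfl h3).trans_le ?_
  rw [← mul_sum, sum_add_distrib, div_eq_mul_one_div 3, mul_comm (3 : ℝ)]
  gcongr
  linarith

/-- Induction on a bound cβ/t² needs 1 + 3cβ ≤ c, where the 1 comes from the term k = t and the 3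
from `sum_Ico_inv_mul_sq_le`. At β = 1/8 the least such c is 8/5. -/
lemma seq_le_of_recurrence {δ : ℕ → ℝ} {β : ℝ} {M : ℕ} (hβ0 : 0 ≤ β) (hβ : β ≤ 1 / 8)
    (h0 : δ 0 = 1)
    (h : ∀ t, 1 ≤ t → t ≤ M → (t : ℝ) * δ t ≤ β * ∑ k ∈ Icc 1 t, δ (t - k) / k)
    (t : ℕ) (ht : 1 ≤ t) (htM : t ≤ M) : δ t ≤ 8 / 5 * β / (t : ℝ) ^ 2 := by
  induction t using Nat.strong_induction_on with
  | _ t ih =>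
    have ht' : (1 : ℝ) ≤ t := by exact_mod_cast ht
    have h1 : ∑ k ∈ Ico 1 t, δ (t - k) / k ≤ 8 / 5 * β * (3 / t) := by
      calc _ ≤ ∑ k ∈ Ico 1 t, 8 / 5 * β * (1 / ((k : ℝ) * ((t - k : ℕ) : ℝ) ^ 2)) := by
            refine sum_le_sum fun k hk => ?_
            rw [mem_Ico] at hk
            have h2 := ih (t - k) (by omega) (by omega) (by omega)
            have : (0 : ℝ) < k := by exact_mod_cast (by omega : 0 < k)
            calc _ ≤ (8 / 5 * β / ((t - k : ℕ) : ℝ) ^ 2) / k := by gcongr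
              _ = _ := by rw [div_div, mul_one_div, mul_comm (k : ℝ)]
        _ ≤ _ := by
            rw [← mul_sum]
            exact mul_le_mul_of_nonneg_left (sum_Ico_inv_mul_sq_le t) (by positivity)
    have h2 := h t ht htM
    rw [← Finset.Ico_add_one_right_eq_Icc, sum_Ico_succ_top ht, Nat.sub_self, h0] at h2
    have h3 : (t : ℝ) * δ t ≤ 8 / 5 * β / t := by
      calc (t : ℝ) * δ t ≤ β * (8 / 5 * β * (3 / t) + 1 / t) :=
            h2.trans (mul_le_mul_of_nonneg_left (by linarith) hβ0)
        _ = (β * (24 / 5 * β + 1)) / t := by ring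
        _ ≤ _ := by
            refine div_le_div_of_nonneg_right ?_ (by positivity)
            nlinarith
    rw [pow_two, ← div_div, le_div_iff₀ (by positivity), mul_comm]
    exact h3

/-- The case q = r = 2, where β = 1/8. The general bound is too weak for small t (at t = 1 the
recurrence gives exactly the claimed 1/8), so t ≤ 5 is computed from the recurrence. -/
lemma seq_le_binomProd_two {δ : ℕ → ℝ} {M : ℕ} (h0 : δ 0 = 1)
    (h : ∀ t, 1 ≤ t → t ≤ M → (t : ℝ) * δ t ≤ 1 / 8 * ∑ k ∈ Icc 1 t, δ (t - k) / k)
    (t : ℕ) (ht : 1 ≤ t) (htM : t ≤ M) : δ t ≤ binomProd 2 (2 * t) / (4 * t) := by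
  have ht' : (1 : ℝ) ≤ t := by exact_mod_cast ht
  rcases Nat.lt_or_ge t 6 with h6 | h6
  · have hb : ∀ m, 1 ≤ m → binomProd 2 (m + 1) = binomProd 2 m * (1 - 1 / (2 * m)) :=
      fun m hm => by exact_mod_cast binomProd_succ 2 hm
    have b1 : binomProd 2 1 = 1 := by simp [binomProd]
    have b2 := hb 1 (by norm_num)
    have b3 := hb 2 (by norm_num)
    have b4 := hb 3 (by norm_num)
    have b5 := hb 4 (by norm_num)
    have b6 := hb 5 (by norm_num)
    have b7 := hb 6 (by norm_num)
    have b8 := hb 7 (by norm_num)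
    have b9 := hb 8 (by norm_num)
    have b10 := hb 9 (by norm_num)
    norm_num at b2 b3 b4 b5 b6 b7 b8 b9 b10
    rw [b1] at b2; rw [b2] at b3; rw [b3] at b4; rw [b4] at b5; rw [b5] at b6; rw [b6] at b7
    rw [b7] at b8; rw [b8] at b9; rw [b9] at b10
    have d1 := fun hM => h 1 (by norm_num) hM
    have d2 := fun hM => h 2 (by norm_num) hM
    have d3 := fun hM => h 3 (by norm_num) hM
    have d4 := fun hM => h 4 (by norm_num) hM
    have d5 := fun hM => h 5 (by norm_num) hM
    simp only [← Finset.Ico_add_one_right_eq_Icc, sum_Ico_eq_sum_range, Finset.sum_range_succ,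
      Nat.reduceAdd, Nat.reduceSub, sum_range_zero, h0] at d1 d2 d3 d4 d5
    norm_num at d1 d2 d3 d4 d5
    interval_cases t
    · have d1 := d1 (by omega)
      norm_num [b2]; linarith
    · have d1 := d1 (by omega)
      have d2 := d2 (by omega)
      norm_num [b4]; linarith
    · have d1 := d1 (by omega)
      have d2 := d2 (by omega)
      have d3 := d3 (by omega)
      norm_num [b6]; linarith
    · have d1 := d1 (by omega)
      have d2 := d2 (by omega)
      have d3 := d3 (by omega)
      have d4 := d4 (by omega)
      norm_num [b8]; linarith
    · have d1 := d1 (by omega)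
      have d2 := d2 (by omega)
      have d3 := d3 (by omega)
      have d4 := d4 (by omega)
      have d5 := d5 (by omega)
      norm_num [b10]; linarith
  · have h1 := seq_le_of_recurrence (by norm_num) le_rfl h0 h t ht htM
    obtain ⟨h2, h3⟩ := binomProd_two_sq (show 1 ≤ 2 * t by omega)
    have h6' : (6 : ℝ) ≤ t := by exact_mod_cast h6
    -- After squaring, this needs 16/(25t²) ≤ 1/(8t), that is t ≥ 5.12, hence the split at 6.
    have h4 : 4 / 5 / (t : ℝ) ≤ binomProd 2 (2 * t) := by
      refine le_of_sq_le_sq ?_ h2.le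
      refine le_trans ?_ h3
      push_cast
      rw [div_pow, div_le_div_iff₀ (by positivity) (by positivity)]
      nlinarith
    refine h1.trans ?_
    calc _ = 4 / 5 / (t : ℝ) / (4 * t) := by field_simp
      _ ≤ _ := by gcongr

lemma sq_mul_le_factorial_mul_pow {r : ℕ} (hr : 4 ≤ r) :
    16 * r ^ 2 ≤ 5 * (r.factorial * 2 ^ (r - 1)) := by
  induction r, hr using Nat.le_induction with
  | base => decide
  | succ r hr ih =>
    obtain ⟨s, rfl⟩ : ∃ s, r = s + 1 := ⟨r - 1, by omega⟩
    simp only [Nat.add_sub_cancel] at ih ⊢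
    rw [Nat.factorial_succ (s + 1), pow_succ 2 s]
    calc 16 * (s + 1 + 1) ^ 2 ≤ 4 * (16 * (s + 1) ^ 2) := by nlinarith
      _ ≤ 4 * (5 * ((s + 1).factorial * 2 ^ s)) := by gcongr
      _ ≤ (2 * (s + 1 + 1)) * (5 * ((s + 1).factorial * 2 ^ s)) := by gcongr; omega
      _ = _ := by ring

lemma seq_le_binomProd {δ : ℕ → ℝ} {q r M : ℕ} (hq : 2 ≤ q) (hr : 2 ≤ r)
    (hr2 : r = 2 → q = 2) (hr3 : r = 3 → q = 3) (h0 : δ 0 = 1)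
    (h : ∀ t, 1 ≤ t → t ≤ M →
      (t : ℝ) * δ t ≤ 1 / ((r.factorial : ℝ) * (q : ℝ) ^ r) * ∑ k ∈ Icc 1 t, δ (t - k) / k)
    (t : ℕ) (ht : 1 ≤ t) (htM : t ≤ M) : δ t ≤ binomProd q (r * t) / (q * (r * t)) := by
  rcases Nat.eq_or_lt_of_le hr with rfl | hr'
  · obtain rfl := hr2 rfl
    norm_num [Nat.factorial] at h
    have := seq_le_binomProd_two h0 (by norm_num; exact h) t ht htM
    convert this using 2
    push_cast; ring
  have ht' : (1 : ℝ) ≤ t := by exact_mod_cast ht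
  have hr0 : (3 : ℝ) ≤ r := by exact_mod_cast hr'
  have hq0 : (2 : ℝ) ≤ q := by exact_mod_cast hq
  -- This is what (8/5)β/t² ≤ 1/(2q(rt)²) becomes for β = 1/(r! q^r). It fails for r = 2, q = 2 and
  -- for r = 3, q = 2, which explains the separate case above and the hypothesis `hr3`.
  have hkey : 16 * (r : ℝ) ^ 2 ≤ 5 * ((r.factorial : ℝ) * (q : ℝ) ^ (r - 1)) := by
    rcases Nat.eq_or_lt_of_le (show 3 ≤ r from hr') with rfl | hr4
    · obtain rfl := hr3 rfl
      norm_num [Nat.factorial]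
    · have h1 : 16 * (r : ℝ) ^ 2 ≤ 5 * ((r.factorial : ℝ) * (2 : ℝ) ^ (r - 1)) := by
        exact_mod_cast sq_mul_le_factorial_mul_pow hr4
      refine h1.trans ?_
      gcongr
  have hpow : (q : ℝ) ^ r = q * (q : ℝ) ^ (r - 1) := by
    rw [← pow_succ', Nat.sub_add_cancel (by omega)]
  have hf : (0 : ℝ) < r.factorial := by exact_mod_cast Nat.factorial_pos r
  have hpos : (0 : ℝ) < (r.factorial : ℝ) * (q : ℝ) ^ (r - 1) := by positivity
  have h1 := seq_le_of_recurrence (by positivity) (by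
    rw [hpow]
    refine one_div_le_one_div_of_le (by norm_num) ?_
    nlinarith) h0 h t ht htM
  obtain ⟨h2, h3⟩ := binomProd_two_sq (show 1 ≤ r * t by nlinarith)
  have hrt : (1 : ℝ) ≤ r * t := by nlinarith
  have h4 : 1 / (2 * ((r : ℝ) * t)) ≤ binomProd q (r * t) := by
    refine le_trans ?_ (binomProd_two_le hq _)
    refine le_of_sq_le_sq ?_ h2.le
    refine le_trans ?_ h3
    push_cast
    rw [div_pow, one_pow]
    refine one_div_le_one_div_of_le (by positivity) ?_
    nlinarith
  calc δ t ≤ _ := h1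
    _ ≤ 1 / (2 * ((r : ℝ) * t)) / (q * (r * t)) := by
      rw [hpow, mul_one_div (8 / 5 : ℝ), div_div, div_div, div_div, div_le_div_iff₀ (by positivity) (by positivity)]
      have : (0 : ℝ) ≤ q * (t : ℝ) ^ 2 := by positivity
      nlinarith [mul_le_mul_of_nonneg_left hkey this]
    _ ≤ _ := by gcongr

/-- The recurrence is that of the coefficients of (1-x)^(1/q). It gives S_(m+1) = S_m (1 - 1/(qm))
for the partial sums S_m. -/
lemma sum_range_eq_binomProd {g : ℕ → ℝ} {q M : ℕ} (hq : 0 < q) (h0 : g 0 = 1)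
    (h : ∀ m, 1 ≤ m → m ≤ M → ((q : ℝ) * m) * g m = -∑ j ∈ range m, g j)
    (m : ℕ) (hm : 1 ≤ m) (hmM : m ≤ M + 1) : ∑ j ∈ range m, g j = binomProd q m := by
  induction m, hm using Nat.le_induction with
  | base => simp [binomProd, h0]
  | succ m hm ih =>
    have h1 := ih (by omega)
    have h2 := h m hm (by omega)
    have : (0 : ℝ) < q := by exact_mod_cast hq
    have : (0 : ℝ) < m := by exact_mod_cast hm
    rw [binomProd_succ q hm, sum_range_succ, ← h1]
    have h3 : g m = -(∑ j ∈ range m, g j) / (q * m) := by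
      rw [← h2]; field_simp
    rw [h3]; ring

end

/-! ### Signs of the coefficients of (1-x)P. -/

section

open PowerSeries Finset

lemma sum_filter_dvd_eq {q N t : ℕ} (hq : 0 < q) (htN : q * t ≤ N) (F : ℕ → ℝ) :
    ∑ k ∈ (Icc 1 N).filter (q ∣ ·), (if k ≤ q * t then F k else 0) =
      ∑ j ∈ Icc 1 t, F (q * j) := by
  rw [← sum_filter]
  symm
  refine sum_bij (fun j _ => q * j) ?_ ?_ ?_ ?_
  · intro j hj
    rw [mem_Icc] at hj
    have : q * j ≤ q * t := Nat.mul_le_mul_left _ hj.2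
    have : 0 < q * j := Nat.mul_pos hq (by omega)
    simp only [mem_filter, mem_Icc, dvd_mul_right, and_true]
    omega
  · intro a _ b _ h
    exact Nat.eq_of_mul_eq_mul_left hq h
  · intro k hk
    simp only [mem_filter, mem_Icc] at hk
    obtain ⟨⟨⟨h1, -⟩, j, rfl⟩, h2⟩ := hk
    refine ⟨j, mem_Icc.2 ⟨?_, Nat.le_of_mul_le_mul_left h2 hq⟩, rfl⟩
    rcases Nat.eq_zero_or_pos j with rfl | h
    · simp at h1
    · exact h
  · intros; rfl

lemma coeff_prod_expMonomial_neg {q N : ℕ} (hq : 2 ≤ q) {m : ℕ} (hm : 1 ≤ m) (hmN : q * m ≤ N) :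
    coeff (q * m) (∏ k ∈ (Icc 1 N).filter (q ∣ ·), expMonomial (-(1 / (k : ℝ))) k) =
      -(binomProd q m / (q * m)) := by
  set B := ∏ k ∈ (Icc 1 N).filter (q ∣ ·), expMonomial (-(1 / (k : ℝ))) k with hB
  have hpos : ∀ k ∈ (Icc 1 N).filter (q ∣ ·), 0 < k := fun k hk =>
    (mem_Icc.1 (mem_filter.1 hk).1).1
  have hrec : ∀ m, 1 ≤ m → m ≤ N / q →
      ((q : ℝ) * m) * coeff (q * m) B = -∑ j ∈ range m, coeff (q * j) B := by
    intro m hm hmN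
    have hmN : q * m ≤ N := by rw [mul_comm]; exact (Nat.le_div_iff_mul_le (by omega)).1 hmN
    have h := coeff_prod_expMonomial_recurrence _ (fun k : ℕ => -(1 / (k : ℝ))) (fun k => k) hpos
      (q * m)
    rw [← hB, sum_filter_dvd_eq (by omega) hmN
      (fun k => ((k : ℝ) * -(1 / (k : ℝ))) * coeff (q * m - k) B)] at h
    rw [← Nat.cast_mul, h, ← sum_neg_distrib, ← Finset.Ico_add_one_right_eq_Icc,
      ← sum_range_reflect, range_eq_Ico, sum_Ico_eq_sum_range, ← range_eq_Ico]
    refine sum_congr (by simp) fun j hj => ?_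
    rw [mem_range] at hj
    have h1 : ((q * (1 + j) : ℕ) : ℝ) ≠ 0 := by positivity
    rw [← Nat.mul_sub, show m - (1 + j) = m - 1 - j by omega]
    field_simp
  have hm' : m ≤ N / q := (Nat.le_div_iff_mul_le (by omega)).2 (by rwa [mul_comm])
  have h1 := sum_range_eq_binomProd (g := fun m => coeff (q * m) B) (by omega)
    (coeff_zero_prod_expMonomial _ _ _) hrec m hm (by omega)
  have h2 := hrec m hm hm'
  rw [h1] at h2
  have : (0 : ℝ) < q := by exact_mod_cast (by omega : 0 < q)
  have : (0 : ℝ) < m := by exact_mod_cast hm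
  rw [← neg_div, ← h2]
  field_simp

lemma binomProd_pos {q : ℕ} (hq : 2 ≤ q) {m : ℕ} (hm : 1 ≤ m) : 0 < binomProd q m :=
  (binomProd_two_sq hm).1.trans_le (binomProd_two_le hq m)

lemma coeff_prod_rootFactor_le {q r N : ℕ} (hq : 2 ≤ q) (hr : 2 ≤ r)
    (hr2 : r = 2 → q = 2) (hr3 : r = 3 → q = 3) {n : ℕ} (hn : 1 ≤ n) (hnN : n ≤ N) :
    coeff n (∏ k ∈ (Icc 1 N).filter (q ∣ ·), rootFactor r k) ≤
      -coeff n (∏ k ∈ (Icc 1 N).filter (q ∣ ·), expMonomial (-(1 / (k : ℝ))) k) ∧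
    coeff n (∏ k ∈ (Icc 1 N).filter (q ∣ ·), expMonomial (-(1 / (k : ℝ))) k) ≤ 0 := by
  have hpos : ∀ k ∈ (Icc 1 N).filter (q ∣ ·), 0 < k := fun k hk =>
    (mem_Icc.1 (mem_filter.1 hk).1).1
  have hdvd : ∀ k ∈ (Icc 1 N).filter (q ∣ ·), q ∣ k := fun k hk => (mem_filter.1 hk).2
  have hle : coeff n (∏ k ∈ (Icc 1 N).filter (q ∣ ·), rootFactor r k) ≤
      coeff n (∏ k ∈ (Icc 1 N).filter (q ∣ ·),
        expMonomial (1 / ((r.factorial : ℝ) * (k : ℝ) ^ r)) (r * k)) :=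
    coeff_prod_le_coeff_prod _ _ _ (fun k _ => coeff_rootFactor_nonneg r k)
      (fun k hk => coeff_rootFactor_le (by omega) (hpos k hk)) n
  have hB : coeff n (∏ k ∈ (Icc 1 N).filter (q ∣ ·), expMonomial (-(1 / (k : ℝ))) k) ≤ 0 := by
    by_cases hqn : q ∣ n
    · obtain ⟨m, rfl⟩ := hqn
      have hm : 1 ≤ m := Nat.pos_of_mul_pos_left (a := q) (by omega)
      rw [coeff_prod_expMonomial_neg hq hm hnN]
      have := binomProd_pos hq hm
      rw [neg_nonpos]
      positivity
    · exact (coeff_prod_expMonomial_eq_zero _ _ _ hpos hdvd n hqn).le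
  refine ⟨hle.trans ?_, hB⟩
  have hposr : ∀ k ∈ (Icc 1 N).filter (q ∣ ·), 0 < r * k := fun k hk =>
    Nat.mul_pos (by omega) (hpos k hk)
  by_cases hqn : r * q ∣ n
  swap
  · rw [coeff_prod_expMonomial_eq_zero _ _ _ hposr (s := r * q)
      (fun k hk => mul_dvd_mul_left r (hdvd k hk)) n hqn]
    linarith
  obtain ⟨t, rfl⟩ := hqn
  have ht : 1 ≤ t := Nat.pos_of_mul_pos_left (a := r * q) (by omega)
  set D := ∏ k ∈ (Icc 1 N).filter (q ∣ ·),
    expMonomial (1 / ((r.factorial : ℝ) * (k : ℝ) ^ r)) (r * k) with hD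
  have hDnn : ∀ n, 0 ≤ coeff n D := fun n => coeff_prod_nonneg _ _ (fun k hk n =>
    (coeff_rootFactor_nonneg r k n).trans (coeff_rootFactor_le (by omega) (hpos k hk) n)) n
  have hr0 : (0 : ℝ) < r := by exact_mod_cast (by omega : 0 < r)
  have hq0 : (0 : ℝ) < q := by exact_mod_cast (by omega : 0 < q)
  have hf : (0 : ℝ) < r.factorial := by exact_mod_cast Nat.factorial_pos r
  have hrec : ∀ u, 1 ≤ u → u ≤ t → (u : ℝ) * coeff (r * q * u) D ≤
      1 / ((r.factorial : ℝ) * (q : ℝ) ^ r) *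
        ∑ k ∈ Icc 1 u, coeff (r * q * (u - k)) D / k := by
    intro u hu hut
    have huN : q * u ≤ N := by
      refine le_trans ?_ hnN
      calc q * u ≤ q * t := Nat.mul_le_mul_left _ hut
        _ ≤ r * (q * t) := Nat.le_mul_of_pos_left _ (by omega)
        _ = _ := by ring
    have h := coeff_prod_expMonomial_recurrence ((Icc 1 N).filter (q ∣ ·))
      (fun k : ℕ => 1 / ((r.factorial : ℝ) * (k : ℝ) ^ r)) (fun k => r * k) hposr (r * q * u)
    rw [← hD] at h
    have h2 : ∀ k, r * k ≤ r * q * u ↔ k ≤ q * u := fun k => by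
      rw [mul_assoc]; exact Nat.mul_le_mul_left_iff (by omega)
    simp only [h2] at h
    rw [sum_filter_dvd_eq (by omega) huN (fun k => ((r * k : ℕ) : ℝ) *
      (1 / ((r.factorial : ℝ) * (k : ℝ) ^ r)) * coeff (r * q * u - r * k) D)] at h
    have h3 : ((r * q * u : ℕ) : ℝ) * coeff (r * q * u) D ≤ ((r : ℝ) * q) *
        (1 / ((r.factorial : ℝ) * (q : ℝ) ^ r) *
          ∑ k ∈ Icc 1 u, coeff (r * q * (u - k)) D / k) := by
      rw [h, mul_sum, mul_sum]
      refine sum_le_sum fun k hk => ?_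
      rw [← mul_assoc r q k, ← Nat.mul_sub]
      have hk1 : (1 : ℝ) ≤ k := by exact_mod_cast (mem_Icc.1 hk).1
      -- The recurrence carries k/k^r; as r ≥ 2 this is at most 1/k, the form required by
      -- `seq_le_binomProd`.
      have hk2 : (k : ℝ) ^ 2 ≤ (k : ℝ) ^ r := pow_le_pow_right₀ hk1 hr
      calc ((r * q * k : ℕ) : ℝ) * (1 / ((r.factorial : ℝ) * ((q * k : ℕ) : ℝ) ^ r)) *
            coeff (r * q * (u - k)) D
          = (r * q * k) * (1 / ((r.factorial : ℝ) * ((q : ℝ) ^ r * (k : ℝ) ^ r))) *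
            coeff (r * q * (u - k)) D := by push_cast; rw [mul_pow]
        _ ≤ (r * q * k) * (1 / ((r.factorial : ℝ) * ((q : ℝ) ^ r * (k : ℝ) ^ 2))) *
            coeff (r * q * (u - k)) D := by
          have := hDnn (r * q * (u - k))
          gcongr
        _ = _ := by field_simp
    push_cast at h3
    rw [mul_assoc ((r : ℝ) * q)] at h3
    exact le_of_mul_le_mul_left h3 (by positivity)
  have h1 := seq_le_binomProd (δ := fun u => coeff (r * q * u) D) hq hr hr2 hr3
    (coeff_zero_prod_expMonomial _ _ _) hrec t ht le_rfl
  have e : r * q * t = q * (r * t) := by ring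
  have h2 := coeff_prod_expMonomial_neg hq (show 1 ≤ r * t by nlinarith) (e ▸ hnN)
  rw [← e] at h2
  rw [h2, neg_neg]
  push_cast
  exact h1

/-- The two end terms of the convolution add up to V_n + B_n ≤ 0; every other term is a nonpositive
B_i times a nonnegative V_j. -/
lemma coeff_mul_nonpos {B V : PowerSeries ℝ} {n : ℕ} (hn : 1 ≤ n) (hB0 : coeff 0 B = 1)
    (hV0 : coeff 0 V = 1) (hV : ∀ m, 0 ≤ coeff m V)
    (hB : ∀ m, 1 ≤ m → m ≤ n → coeff m B ≤ 0) (hVB : coeff n V ≤ -coeff n B) :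
    coeff n (B * V) ≤ 0 := by
  have h1 : ((0, n) : ℕ × ℕ) ∈ HasAntidiagonal.antidiagonal n := by simp
  have h2 : ((n, 0) : ℕ × ℕ) ∈ (HasAntidiagonal.antidiagonal n).erase (0, n) := by
    simp; omega
  rw [coeff_mul, ← add_sum_erase _ _ h1, ← add_sum_erase _ _ h2, hB0, hV0, one_mul, mul_one]
  have h3 : ∑ p ∈ ((HasAntidiagonal.antidiagonal n).erase (0, n)).erase (n, 0),
      coeff p.1 B * coeff p.2 V ≤ 0 := by
    refine sum_nonpos fun p hp => mul_nonpos_of_nonpos_of_nonneg (hB _ ?_ ?_) (hV _)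
    all_goals
      obtain ⟨i, j⟩ := p
      simp only [mem_erase, HasAntidiagonal.mem_antidiagonal, ne_eq, Prod.mk.injEq] at hp
      dsimp only
      omega
  linarith

/-- The factor of the generating function of permutations with a root that belongs to cycles of
length `k`, for a prime power exponent `r` of the prime `q`. -/
noncomputable def permRootFactor (q r k : ℕ) : PowerSeries ℝ :=
  if q ∣ k then rootFactor r k else expMonomial (1 / (k : ℝ)) k

lemma coeff_one_sub_X_mul_prod_permRootFactor_nonpos {q r N : ℕ} (hq : 2 ≤ q) (hr : 2 ≤ r)
    (hr2 : r = 2 → q = 2) (hr3 : r = 3 → q = 3) {n : ℕ} (hn : 1 ≤ n) (hnN : n ≤ N) :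
    coeff n ((1 - X) * ∏ k ∈ Icc 1 N, permRootFactor q r k) ≤ 0 := by
  -- For `q ∣ k`, the factor exp(x^k/k) is inserted and cancelled by exp(-x^k/k), so that the full
  -- product 1/(1-x) appears.
  have hfac : ∏ k ∈ Icc 1 N, permRootFactor q r k = (∏ k ∈ Icc 1 N, expMonomial (1 / (k : ℝ)) k) *
      ((∏ k ∈ (Icc 1 N).filter (q ∣ ·), expMonomial (-(1 / (k : ℝ))) k) *
        ∏ k ∈ (Icc 1 N).filter (q ∣ ·), rootFactor r k) := by
    rw [prod_filter, prod_filter, ← prod_mul_distrib, ← prod_mul_distrib]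
    refine prod_congr rfl fun k hk => ?_
    rw [permRootFactor]
    split_ifs
    · rw [← mul_assoc, expMonomial_mul_neg _ (mem_Icc.1 hk).1, one_mul]
    · simp
  rw [hfac, ← mul_assoc, coeff_mul, sum_eq_single (0, n)]
  · rw [coeff_one_sub_X_mul_prod_expMonomial N 0 (Nat.zero_le _), if_pos rfl, one_mul]
    refine coeff_mul_nonpos hn (coeff_zero_prod_expMonomial _ _ _) ?_ (fun m => ?_)
      (fun m hm hmn => ?_) ?_
    · rw [coeff_zero_eq_constantCoeff, map_prod]
      refine prod_eq_one fun k _ => ?_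
      rw [← coeff_zero_eq_constantCoeff, coeff_zero_rootFactor]
    · exact coeff_prod_nonneg _ _ (fun k _ => coeff_rootFactor_nonneg r k) m
    · exact (coeff_prod_rootFactor_le hq hr hr2 hr3 hm (hmn.trans hnN)).2
    · exact (coeff_prod_rootFactor_le hq hr hr2 hr3 hn hnN).1
  · rintro ⟨i, j⟩ hij hne
    rw [HasAntidiagonal.mem_antidiagonal] at hij
    dsimp only at hij ⊢
    rw [coeff_one_sub_X_mul_prod_expMonomial N i (by omega), if_neg, zero_mul]
    rintro rfl
    exact hne (by simp at hij; rw [hij])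
  · intro h
    exact absurd (by simp) h

end

/-! ### Cycle types of prime power roots. -/

section

open Finset Function Equiv.Perm

lemma minimalPeriod_eq_card_support_cycleOf {α : Type*} [Fintype α] [DecidableEq α]
    (σ : Equiv.Perm α) {x : α} (hx : x ∈ σ.support) :
    minimalPeriod σ x = #(σ.cycleOf x).support := by
  have hmem : x ∈ (σ.cycleOf x).support := mem_support_cycleOf_iff.2 ⟨SameCycle.refl σ x, hx⟩
  have h : ∀ n, IsPeriodicPt σ n x ↔ #(σ.cycleOf x).support ∣ n := fun n => by
    rw [← (isCycleOn_support_cycleOf σ x).pow_apply_eq hmem, IsPeriodicPt, IsFixedPt,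
      Equiv.Perm.iterate_eq_pow]
  exact Nat.dvd_antisymm (((h _).2 dvd_rfl).minimalPeriod_dvd)
    ((h _).1 (isPeriodicPt_minimalPeriod _ _))

lemma minimalPeriod_perm_pos {α : Type*} [Finite α] (σ : Equiv.Perm α) (x : α) :
    0 < minimalPeriod σ x :=
  minimalPeriod_pos_of_mem_periodicPts
    (by rw [injective_iff_periodicPts_eq_univ.1 σ.injective]; trivial)

/-- Counting points by period replaces any description of how individual cycles split under powers.
Fixed points are absent from `cycleType`, hence 2 ≤ k. -/
lemma card_filter_minimalPeriod_eq {α : Type*} [Fintype α] [DecidableEq α]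
    (σ : Equiv.Perm α) {k : ℕ} (hk : 2 ≤ k) :
    #{x | minimalPeriod σ x = k} = k * σ.cycleType.count k := by
  have h : ({x | minimalPeriod σ x = k} : Finset α) =
      (σ.cycleFactorsFinset.filter (fun c => #c.support = k)).biUnion (fun c => c.support) := by
    ext x
    simp only [mem_filter, mem_univ, true_and, mem_biUnion]
    constructor
    · intro hx
      have hxs : x ∈ σ.support := by
        rw [Equiv.Perm.mem_support]
        intro h
        have := minimalPeriod_eq_one_iff_isFixedPt.2 h
        omega
      exact ⟨σ.cycleOf x, ⟨cycleOf_mem_cycleFactorsFinset_iff.2 hxs,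
        by rw [← minimalPeriod_eq_card_support_cycleOf σ hxs, hx]⟩,
        mem_support_cycleOf_iff.2 ⟨SameCycle.refl σ x, hxs⟩⟩
    · rintro ⟨c, ⟨hc, hck⟩, hxc⟩
      rw [minimalPeriod_eq_card_support_cycleOf σ (mem_cycleFactorsFinset_support_le hc hxc),
        ← cycle_is_cycleOf hxc hc, hck]
  rw [h, card_biUnion]
  · rw [sum_congr rfl (fun c hc => (mem_filter.1 hc).2), sum_const, smul_eq_mul, mul_comm,
      cycleType_def, Multiset.count_map]
    congr 1
    rw [Finset.card_def, Finset.filter_val]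
    congr 1
    refine Multiset.filter_congr fun c _ => ?_
    rw [comp_apply, eq_comm]
  · intro c hc d hd hcd
    exact (cycleFactorsFinset_pairwise_disjoint σ (mem_filter.1 hc).1 (mem_filter.1 hd).1
      hcd).disjoint_support

lemma minimalPeriod_perm_pow {α : Type*} (π : Equiv.Perm α) {r : ℕ} (hr : r ≠ 0) (x : α) :
    minimalPeriod (π ^ r : Equiv.Perm α) x =
      minimalPeriod π x / Nat.gcd (minimalPeriod π x) r := by
  rw [← minimalPeriod_iterate_eq_div_gcd hr, Equiv.Perm.iterate_eq_pow]

/-- Write gcd = q^j, so m = q^j k. If j < l then, as q divides k, q^(j+1) would also divide both m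
and q^l. -/
lemma div_gcd_prime_pow_eq_iff {q l m k : ℕ} (hq : q.Prime) (hk : q ∣ k) (hm : 0 < m) :
    m / Nat.gcd m (q ^ l) = k ↔ m = q ^ l * k := by
  have hql : 0 < q ^ l := pow_pos hq.pos l
  constructor
  · intro h
    obtain ⟨j, hj, hg⟩ := (Nat.dvd_prime_pow hq).1 (Nat.gcd_dvd_right m (q ^ l))
    have hm' : m = q ^ j * k := by
      rw [← h, ← hg, Nat.mul_div_cancel' (Nat.gcd_dvd_left _ _)]
    rcases Nat.lt_or_ge j l with hjl | hjl
    · exfalso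
      have h1 : q ^ (j + 1) ∣ Nat.gcd m (q ^ l) := by
        refine Nat.dvd_gcd ?_ (pow_dvd_pow q hjl)
        rw [hm', pow_succ]
        exact mul_dvd_mul_left _ hk
      rw [hg] at h1
      have := (Nat.pow_dvd_pow_iff_le_right hq.one_lt).1 h1
      omega
    · rwa [show j = l by omega] at hm'
  · rintro rfl
    rw [Nat.gcd_eq_right (dvd_mul_right _ _), Nat.mul_div_cancel_left _ hql]

lemma count_cycleType_pow_of_dvd {α : Type*} [Fintype α] [DecidableEq α] {q l k : ℕ}
    (hq : q.Prime) (hk : q ∣ k) (hk0 : 0 < k) (π : Equiv.Perm α) :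
    (π ^ q ^ l).cycleType.count k = q ^ l * π.cycleType.count (q ^ l * k) := by
  have hql : 0 < q ^ l := pow_pos hq.pos l
  have hk2 : 2 ≤ k := hq.two_le.trans (Nat.le_of_dvd hk0 hk)
  have h1 := card_filter_minimalPeriod_eq (π ^ q ^ l) hk2
  have h2 := card_filter_minimalPeriod_eq π (show 2 ≤ q ^ l * k by nlinarith)
  have h3 : ({x | minimalPeriod (π ^ q ^ l : Equiv.Perm α) x = k} : Finset α) =
      ({x | minimalPeriod π x = q ^ l * k} : Finset α) := by
    refine filter_congr fun x _ => ?_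
    rw [minimalPeriod_perm_pow π hql.ne', div_gcd_prime_pow_eq_iff hq hk
      (minimalPeriod_perm_pos π x)]
  rw [h3, h2] at h1
  exact Nat.eq_of_mul_eq_mul_left hk0 (by rw [← h1]; ring)

/-- The part of `s` prime to `q`, together with `count k s / r` copies of `r * k` for every
multiple `k` of `q`. -/
def rootCycleType (q r : ℕ) (s : Multiset ℕ) : Multiset ℕ :=
  ∑ k ∈ s.toFinset, if q ∣ k then Multiset.replicate (s.count k / r) (r * k)
    else Multiset.replicate (s.count k) k

lemma sum_rootCycleType {q r : ℕ} {s : Multiset ℕ} (h : ∀ k, q ∣ k → r ∣ s.count k) :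
    (rootCycleType q r s).sum = s.sum := by
  rw [Finset.sum_multiset_count s, rootCycleType, ← Multiset.coe_sumAddMonoidHom, map_sum]
  refine sum_congr rfl fun k _ => ?_
  rw [Multiset.coe_sumAddMonoidHom]
  split_ifs with hk
  · rw [Multiset.sum_replicate, smul_eq_mul, smul_eq_mul, ← mul_assoc,
      Nat.div_mul_cancel (h k hk)]
  · rw [Multiset.sum_replicate]

lemma count_rootCycleType_of_dvd {q r k : ℕ} (hr : 0 < r) (hqr : q ∣ r) (hk : q ∣ k)
    (s : Multiset ℕ) : (rootCycleType q r s).count (r * k) = s.count k / r := by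
  rw [rootCycleType, Multiset.count_sum', sum_eq_single k]
  · rw [if_pos hk, Multiset.count_replicate_self]
  · intro j _ hj
    split_ifs with h
    · rw [Multiset.count_replicate, if_neg]
      exact fun h' => hj (Nat.eq_of_mul_eq_mul_left hr h')
    · rw [Multiset.count_replicate, if_neg]
      rintro rfl
      exact h (hqr.mul_right k)
  · intro h
    rw [if_pos hk, Multiset.count_replicate_self,
      Multiset.count_eq_zero_of_notMem (by simpa using h), Nat.zero_div]

lemma count_rootCycleType_of_not_dvd {q r k : ℕ} (hk : ¬ q ∣ k) (s : Multiset ℕ) :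
    (rootCycleType q r s).count k = s.count k := by
  rw [rootCycleType, Multiset.count_sum', sum_eq_single k]
  · rw [if_neg hk, Multiset.count_replicate_self]
  · intro j _ hj
    split_ifs with h
    · rw [Multiset.count_replicate, if_neg]
      rintro rfl
      exact hk (h.mul_left r)
    · rw [Multiset.count_replicate, if_neg hj]
  · intro h
    rw [if_neg hk, Multiset.count_replicate_self,
      Multiset.count_eq_zero_of_notMem (by simpa using h)]

lemma mem_rootCycleType {q r m : ℕ} {s : Multiset ℕ} (h : m ∈ rootCycleType q r s) :
    ∃ k ∈ s, (q ∣ k ∧ m = r * k) ∨ (¬ q ∣ k ∧ m = k) := by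
  rw [rootCycleType, Multiset.mem_sum] at h
  obtain ⟨k, hk, hm⟩ := h
  refine ⟨k, by simpa using hk, ?_⟩
  split_ifs at hm with hq
  · exact Or.inl ⟨hq, Multiset.eq_of_mem_replicate hm⟩
  · exact Or.inr ⟨hq, Multiset.eq_of_mem_replicate hm⟩

/-- By `hπ`, cycles of length divisible by q break into cycles of length still divisible by q. The
other lengths are prime to q^l and so are preserved. -/
lemma count_cycleType_pow_of_not_dvd {α : Type*} [Fintype α] [DecidableEq α] {q l k : ℕ}
    (hq : q.Prime) (hk : ¬ q ∣ k) (hk2 : 2 ≤ k) {π : Equiv.Perm α}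
    (hπ : ∀ m ∈ π.cycleType, q ∣ m → ∃ j, q ∣ j ∧ m = q ^ l * j) :
    (π ^ q ^ l).cycleType.count k = π.cycleType.count k := by
  have hql : 0 < q ^ l := pow_pos hq.pos l
  have h1 := card_filter_minimalPeriod_eq (π ^ q ^ l) hk2
  have h2 := card_filter_minimalPeriod_eq π hk2
  have h3 : ({x | minimalPeriod (π ^ q ^ l : Equiv.Perm α) x = k} : Finset α) =
      ({x | minimalPeriod π x = k} : Finset α) := by
    refine filter_congr fun x _ => ?_
    rw [minimalPeriod_perm_pow π hql.ne']
    by_cases hd : q ∣ minimalPeriod π x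
    · refine iff_of_false (fun h => ?_) (fun h => hk (h ▸ hd))
      have hx : x ∈ π.support := by
        rw [Equiv.Perm.mem_support]
        intro hfix
        rw [minimalPeriod_eq_one_iff_isFixedPt.2 hfix] at hd
        exact hq.one_lt.ne' (Nat.dvd_one.1 hd)
      have hmem : minimalPeriod π x ∈ π.cycleType := by
        rw [minimalPeriod_eq_card_support_cycleOf π hx, cycleType_def]
        exact Multiset.mem_map.2 ⟨_, cycleOf_mem_cycleFactorsFinset_iff.2 hx, rfl⟩
      obtain ⟨j, hj, hm⟩ := hπ _ hmem hd
      rw [(div_gcd_prime_pow_eq_iff hq hj (minimalPeriod_perm_pos π x)).2 hm] at h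
      exact hk (h ▸ hj)
    · have : Nat.Coprime (minimalPeriod π x) (q ^ l) :=
        ((hq.coprime_iff_not_dvd.2 hd).symm).pow_right l
      rw [this, Nat.div_one]
  rw [h3, h2] at h1
  exact (Nat.eq_of_mul_eq_mul_left (by omega) h1).symm

/-- For the converse, r cycles of length k with `q ∣ k` are merged into one of length rk, and the
other lengths are kept. The r-th power of a permutation of that type is conjugate to σ, and the
conjugation carries the root along. -/
lemma hasPermRoot_prime_pow_iff {α : Type*} [Fintype α] [DecidableEq α] {q l : ℕ}
    (hq : q.Prime) (hl : 1 ≤ l) (σ : Equiv.Perm α) :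
    HasPermRoot (q ^ l) σ ↔ ∀ k, q ∣ k → q ^ l ∣ σ.cycleType.count k := by
  have hql : 0 < q ^ l := pow_pos hq.pos l
  have hzero : ∀ τ : Equiv.Perm α, ∀ k, k < 2 → τ.cycleType.count k = 0 := fun τ k hk =>
    Multiset.count_eq_zero_of_notMem fun h => by
      have := two_le_of_mem_cycleType h
      omega
  constructor
  · rintro ⟨π, rfl⟩ k hk
    rcases Nat.eq_zero_or_pos k with rfl | hk0
    · rw [hzero _ 0 (by norm_num)]; exact dvd_zero _
    · rw [count_cycleType_pow_of_dvd hq hk hk0]; exact dvd_mul_right _ _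
  · intro h
    obtain ⟨π, hπ⟩ := (exists_with_cycleType_iff α (m := rootCycleType q (q ^ l) σ.cycleType)).2 (by
      refine ⟨by rw [sum_rootCycleType h]; exact sum_cycleType_le σ, fun m hm => ?_⟩
      obtain ⟨k, hk, ⟨-, rfl⟩ | ⟨-, rfl⟩⟩ := mem_rootCycleType hm
      · exact (two_le_of_mem_cycleType hk).trans (Nat.le_mul_of_pos_left _ hql)
      · exact two_le_of_mem_cycleType hk)
    have hct : (π ^ q ^ l).cycleType = σ.cycleType := by
      ext k
      rcases Nat.lt_or_ge k 2 with hk2 | hk2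
      · rw [hzero _ k hk2, hzero _ k hk2]
      by_cases hk : q ∣ k
      · rw [count_cycleType_pow_of_dvd hq hk (by omega), hπ,
          count_rootCycleType_of_dvd hql (dvd_pow_self q (by omega)) hk,
          Nat.mul_div_cancel' (h k hk)]
      · rw [count_cycleType_pow_of_not_dvd hq hk hk2, hπ, count_rootCycleType_of_not_dvd hk]
        intro m hm hqm
        rw [hπ] at hm
        obtain ⟨j, -, ⟨hj, hm⟩ | ⟨hj, rfl⟩⟩ := mem_rootCycleType hm
        · exact ⟨j, hj, hm⟩
        · exact absurd hqm hj
    obtain ⟨c, hc⟩ := isConj_iff.1 (isConj_iff_cycleType_eq.2 hct)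
    exact ⟨c * π * c⁻¹, by rw [conj_pow, hc]⟩

end

/-! ### The generating function as a sum over partitions. -/

section

open Finset PowerSeries

/-- The weight of `j` cycles of length `k` in the count of permutations with a root, divided by
the factorial. -/
noncomputable def permRootWeight (q r k j : ℕ) : ℝ :=
  if q ∣ k ∧ ¬ r ∣ j then 0 else (1 / (k : ℝ)) ^ j / (j.factorial : ℝ)

lemma permRootWeight_zero (q r k : ℕ) : permRootWeight q r k 0 = 1 := by
  simp [permRootWeight]

lemma permRootFactor_eq_spreadSeries (q r k : ℕ) :
    permRootFactor q r k = spreadSeries (permRootWeight q r k) k := by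
  unfold permRootFactor rootFactor expMonomial permRootWeight
  split_ifs with h
  · congr 1; ext j; by_cases hj : r ∣ j <;> simp [h, hj]
  · simp [h]

section
open scoped PowerSeries.WithPiTopology

lemma one_add_tsum_eq_spreadSeries (f : ℕ → ℝ) (h0 : f 0 = 1) {d : ℕ} (hd : d ≠ 0)
    (hs : Summable fun j ↦ f (j + 1) • (X : PowerSeries ℝ) ^ (d * (j + 1))) :
    1 + ∑' j, f (j + 1) • (X : PowerSeries ℝ) ^ (d * (j + 1)) = spreadSeries f d := by
  ext n
  rw [map_add, hs.map_tsum _ (WithPiTopology.continuous_coeff ℝ n), coeff_spreadSeries]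
  simp only [map_smul, coeff_X_pow, smul_eq_mul, mul_ite, mul_one, mul_zero]
  split_ifs with h
  · obtain ⟨j, rfl⟩ := h
    rw [Nat.mul_div_cancel_left _ (Nat.pos_of_ne_zero hd)]
    rcases j with _ | j
    · simp [h0, hd]
    · rw [tsum_eq_single j]
      · simp [coeff_one, hd]
      · intro b hb
        rw [if_neg]
        intro h
        have := Nat.eq_of_mul_eq_mul_left (Nat.pos_of_ne_zero hd) h
        omega
  · have hn : n ≠ 0 := by rintro rfl; simp at h
    rw [coeff_one, if_neg hn, zero_add]
    convert tsum_zero with j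
    rw [if_neg]
    rintro rfl
    exact h (dvd_mul_right _ _)

/-- Factors with k > n are 1 up to degree n, so the coefficients of the partial products converging
to `genFun` stabilise from n on. -/
lemma coeff_prod_Icc_spreadSeries (f : ℕ → ℕ → ℝ) (h0 : ∀ k, f k 0 = 1) {n N : ℕ} (hnN : n ≤ N) :
    coeff n (∏ k ∈ Icc 1 N, spreadSeries (f k) k) = coeff n (Nat.Partition.genFun f) := by
  have hstep : ∀ M, n ≤ M → coeff n (∏ k ∈ range M, spreadSeries (f (k + 1)) (k + 1)) =
      coeff n (∏ k ∈ range n, spreadSeries (f (k + 1)) (k + 1)) := by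
    intro M hM
    induction M, hM using Nat.le_induction with
    | base => rfl
    | succ M hM ih =>
      rw [prod_range_succ, coeff_mul, sum_eq_single (n, 0), ih]
      · simp [coeff_spreadSeries, h0]
      · rintro ⟨i, j⟩ hij hne
        rw [HasAntidiagonal.mem_antidiagonal] at hij
        dsimp only at hij ⊢
        rw [coeff_spreadSeries, if_neg, mul_zero]
        intro hd
        rcases Nat.eq_zero_or_pos j with rfl | hj
        · exact hne (by simp at hij; rw [hij])
        · have := Nat.le_of_dvd hj hd
          omega
      · intro h
        exact absurd (by simp) h
  have hprod := Nat.Partition.hasProd_genFun f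
  have hterm : (fun i ↦ 1 + ∑' j, f (i + 1) (j + 1) • (X : PowerSeries ℝ) ^ ((i + 1) * (j + 1))) =
      fun i => spreadSeries (f (i + 1)) (i + 1) := by
    ext1 i
    exact one_add_tsum_eq_spreadSeries (f (i + 1)) (h0 _) (by omega)
      (Nat.Partition.summable_genFun_term f i)
  rw [hterm] at hprod
  have hlim := ((WithPiTopology.continuous_coeff ℝ n).tendsto _).comp hprod.tendsto_prod_nat
  have hconst : Filter.Tendsto (fun M => coeff n (∏ k ∈ range M,
      spreadSeries (f (k + 1)) (k + 1))) Filter.atTop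
      (nhds (coeff n (∏ k ∈ range n, spreadSeries (f (k + 1)) (k + 1)))) :=
    tendsto_atTop_of_eventually_const (i₀ := n) fun M hM => hstep M hM
  have heq := tendsto_nhds_unique hlim hconst
  rw [heq, ← hstep N hnN, ← Finset.Ico_add_one_right_eq_Icc, prod_Ico_eq_prod_range]
  simp [add_comm]

end

lemma Nat.Partition.parts_eq_filter_add_replicate {n : ℕ} (p : n.Partition) :
    p.parts = p.parts.filter (2 ≤ ·) + Multiset.replicate (p.parts.count 1) 1 := by
  conv_lhs => rw [← Multiset.filter_add_not (2 ≤ ·) p.parts]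
  congr 1
  rw [← Multiset.filter_eq]
  refine Multiset.filter_congr fun k hk => ?_
  have := p.parts_pos hk
  omega

lemma partition_eq_iff_cycleType_eq {α : Type*} [Fintype α] [DecidableEq α] (σ : Equiv.Perm α)
    (p : (Fintype.card α).Partition) :
    σ.partition = p ↔ σ.cycleType = p.parts.filter (2 ≤ ·) := by
  constructor
  · rintro rfl
    exact Equiv.Perm.filter_parts_partition_eq_cycleType.symm
  · intro h
    have hp := p.parts_eq_filter_add_replicate
    have hs := congrArg Multiset.sum hp
    rw [p.parts_sum, Multiset.sum_add, Multiset.sum_replicate, smul_eq_mul, mul_one, ← h,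
      Equiv.Perm.sum_cycleType] at hs
    rw [Nat.Partition.ext_iff, Equiv.Perm.parts_partition, hp, h,
      show Fintype.card α - #σ.support = p.parts.count 1 by omega]

/-- Cauchy's formula n!/∏ k^c_k c_k!. Parts equal to 1 are fixed points, which `cycleType` omits, so
their factor c_1! is restored separately. -/
lemma card_partition_eq {α : Type*} [Fintype α] [DecidableEq α]
    (p : (Fintype.card α).Partition) :
    (#{σ : Equiv.Perm α | σ.partition = p} : ℝ) = ((Fintype.card α).factorial : ℝ) *
      ∏ k ∈ p.parts.toFinset, ((1 / (k : ℝ)) ^ p.parts.count k / ((p.parts.count k).factorial : ℝ)) := by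
  set m := p.parts.filter (2 ≤ ·) with hm
  have hp : p.parts = m + Multiset.replicate (p.parts.count 1) 1 :=
    p.parts_eq_filter_add_replicate
  have hs := congrArg Multiset.sum hp
  rw [p.parts_sum, Multiset.sum_add, Multiset.sum_replicate, smul_eq_mul, mul_one] at hs
  have hcard := Equiv.Perm.card_of_cycleType_mul_eq α m
  rw [if_pos ⟨by omega, fun a ha => (Multiset.mem_filter.1 ha).2⟩] at hcard
  have h1 : 1 ∉ m.toFinset := by simp [hm]
  have hfac : ∏ k ∈ p.parts.toFinset, (p.parts.count k).factorial =
      (Fintype.card α - m.sum).factorial * ∏ k ∈ m.toFinset, (m.count k).factorial := by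
    rw [prod_subset (s₂ := insert 1 m.toFinset), prod_insert h1,
      show Fintype.card α - m.sum = p.parts.count 1 by omega]
    · congr 1
      refine prod_congr rfl fun k hk => ?_
      rw [hm, Multiset.count_filter_of_pos]
      exact (Multiset.mem_filter.1 (Multiset.mem_toFinset.1 hk)).2
    · intro k hk
      rw [Multiset.mem_toFinset] at hk
      have := p.parts_pos hk
      rw [mem_insert, Multiset.mem_toFinset, hm, Multiset.mem_filter]
      by_cases h : k = 1
      · exact Or.inl h
      · exact Or.inr ⟨hk, by omega⟩
    · intro k _ hk
      rw [Multiset.count_eq_zero_of_notMem (by simpa using hk), Nat.factorial_zero]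
  have hprod : ∏ k ∈ p.parts.toFinset, k ^ p.parts.count k = m.prod := by
    rw [← Finset.prod_multiset_count]
    conv_lhs => rw [hp]
    simp
  have hW : (∏ k ∈ p.parts.toFinset,
      ((1 / (k : ℝ)) ^ p.parts.count k / ((p.parts.count k).factorial : ℝ))) *
      (((Fintype.card α - m.sum).factorial * m.prod * ∏ k ∈ m.toFinset, (m.count k).factorial : ℕ) :
        ℝ) = 1 := by
    rw [show (Fintype.card α - m.sum).factorial * m.prod *
      ∏ k ∈ m.toFinset, (m.count k).factorial =
      ∏ k ∈ p.parts.toFinset, (k ^ p.parts.count k * (p.parts.count k).factorial) by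
        rw [prod_mul_distrib, hprod, hfac]; ring]
    push_cast
    rw [← prod_mul_distrib]
    refine prod_eq_one fun k hk => ?_
    have hk0 : (k : ℝ) ≠ 0 := by
      exact_mod_cast (p.parts_pos (Multiset.mem_toFinset.1 hk)).ne'
    have := Nat.factorial_ne_zero (p.parts.count k)
    rw [div_pow, one_pow]
    field_simp
  have hset : ({σ : Equiv.Perm α | σ.partition = p} : Finset (Equiv.Perm α)) =
      ({σ : Equiv.Perm α | σ.cycleType = m} : Finset (Equiv.Perm α)) :=
    filter_congr fun σ _ => partition_eq_iff_cycleType_eq σ p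
  rw [hset, ← hcard]
  push_cast at hW ⊢
  rw [mul_assoc, mul_comm _ (∏ k ∈ p.parts.toFinset, _), hW, mul_one]

open Classical in
lemma prod_permRootWeight (q r : ℕ) (s : Multiset ℕ) :
    s.toFinsupp.prod (permRootWeight q r) =
      if ∀ k, q ∣ k → r ∣ s.count k then
        ∏ k ∈ s.toFinset, ((1 / (k : ℝ)) ^ s.count k / ((s.count k).factorial : ℝ)) else 0 := by
  rw [Finsupp.prod, Multiset.toFinsupp_support]
  simp only [Multiset.toFinsupp_apply]
  split_ifs with h
  · refine prod_congr rfl fun k _ => ?_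
    rw [permRootWeight, if_neg]
    rintro ⟨h1, h2⟩
    exact h2 (h k h1)
  · push Not at h
    obtain ⟨k, hk, hr⟩ := h
    refine prod_eq_zero (i := k) ?_ (by rw [permRootWeight, if_pos ⟨hk, hr⟩])
    rw [Multiset.mem_toFinset]
    by_contra hmem
    exact hr (by rw [Multiset.count_eq_zero_of_notMem hmem]; exact dvd_zero r)

lemma hasPermRoot_iff_partition {α : Type*} [Fintype α] [DecidableEq α] {q l : ℕ}
    (hq : q.Prime) (hl : 1 ≤ l) (σ : Equiv.Perm α) :
    HasPermRoot (q ^ l) σ ↔ ∀ k, q ∣ k → q ^ l ∣ σ.partition.parts.count k := by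
  rw [hasPermRoot_prime_pow_iff hq hl]
  refine forall₂_congr fun k hk => ?_
  rw [Equiv.Perm.parts_partition, Multiset.count_add, Multiset.count_replicate, if_neg, add_zero]
  rintro rfl
  exact hq.one_lt.ne' (Nat.dvd_one.1 hk)

lemma card_hasPermRoot_div_factorial (α : Type*) [Fintype α] [DecidableEq α] {q l : ℕ}
    (hq : q.Prime) (hl : 1 ≤ l) :
    (Nat.card {σ : Equiv.Perm α // HasPermRoot (q ^ l) σ} : ℝ) / (Nat.card (Equiv.Perm α) : ℝ) =
      coeff (Fintype.card α) (Nat.Partition.genFun (permRootWeight q (q ^ l))) := by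
  classical
  have hn : ((Fintype.card α).factorial : ℝ) ≠ 0 := by
    exact_mod_cast Nat.factorial_ne_zero _
  rw [Nat.card_eq_fintype_card (α := Equiv.Perm α), Fintype.card_perm, div_eq_iff hn,
    Nat.Partition.coeff_genFun, sum_mul, Nat.card_eq_fintype_card, Fintype.card_subtype,
    card_eq_sum_card_fiberwise (f := fun σ : Equiv.Perm α => σ.partition) (t := univ)
      (fun _ _ => by simp), Nat.cast_sum]
  refine sum_congr rfl fun p _ => ?_
  rw [prod_permRootWeight]
  split_ifs with h
  · rw [mul_comm, ← card_partition_eq]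
    congr 2
    ext σ
    simp only [mem_filter, mem_univ, true_and]
    refine ⟨fun h => h.2, fun h' => ⟨?_, h'⟩⟩
    rw [hasPermRoot_iff_partition hq hl, h']
    exact h
  · rw [zero_mul, Nat.cast_eq_zero, card_eq_zero, filter_eq_empty_iff]
    intro σ hσ h'
    rw [mem_filter, hasPermRoot_iff_partition hq hl, h'] at hσ
    exact h hσ.2

lemma rootProb_prime_pow_eq_coeff {q l : ℕ} (hq : q.Prime) (hl : 1 ≤ l) {n N : ℕ} (hnN : n ≤ N) :
    rootProb (q ^ l) n = coeff n (∏ k ∈ Icc 1 N, permRootFactor q (q ^ l) k) := by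
  rw [rootProb, card_hasPermRoot_div_factorial (Fin n) hq hl, Fintype.card_fin,
    ← coeff_prod_Icc_spreadSeries _ (permRootWeight_zero q (q ^ l)) hnN]
  simp only [permRootFactor_eq_spreadSeries]

end

theorem mainTheorem3 (q l r n : ℕ) (hq : q.Prime) (hl : 1 ≤ l) (hr : r = q ^ l) (hn : 1 ≤ n) :
    rootProb r (n + 1) ≤ rootProb r n := by
  subst hr
  have hqr : q ≤ q ^ l := Nat.le_self_pow (by omega) q
  -- A prime power of q that is itself prime equals q; this supplies the conditions on r = 2 and r =
  -- 3.
  have hpow : ∀ p : ℕ, p.Prime → q ^ l = p → p = q := fun p hp h =>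
    ((Nat.prime_dvd_prime_iff_eq hq hp).1 (h ▸ dvd_pow_self q (by omega))).symm
  have h := coeff_one_sub_X_mul_prod_permRootFactor_nonpos hq.two_le (hq.two_le.trans hqr)
    (fun h => (hpow 2 Nat.prime_two h).symm) (fun h => (hpow 3 Nat.prime_three h).symm)
    (show 1 ≤ n + 1 by omega) (le_refl (n + 1))
  rw [sub_mul, one_mul, map_sub, PowerSeries.coeff_succ_X_mul,
    ← rootProb_prime_pow_eq_coeff hq hl (le_refl (n + 1)),
    ← rootProb_prime_pow_eq_coeff hq hl (Nat.le_succ n)] at h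
  linarith
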